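/- **Setting.** The state space $\Theta\subset\mathbb{R}^n$ is convex and compact; the prior $\mu_0$ is an atomless Borel probability measure on $\Theta$ with $\operatorname{supp}\mu_0=\Theta$. A sender observes $\theta\in\Theta$ and sends a message $m$, a nonempty Borel subset of $\Theta$ with $\theta\in m$; $M$ denotes the set of all nonempty Borel subsets of $\Theta$, equipped with any $\sigma$-algebra containing the singletons. The receiver observes $m$ and takes an action in $J=\{1,\dots,K\}$, $K\ge 2$. The sender's payoff is a strictly increasing $v:J\to\mathbb{R}$; the receiver's payoff $u:J\times\Theta\to\mathbb{R}$ is bounded and measurable. **Equilibrium.** An equilibrium is a triple $(\sigma,\tau,q)$, where $\sigma(\cdot\mid\theta)$ is a finitely supported probability measure on $M$ for each $\theta$, depending measurably on $\theta$; $\tau:M\to\Delta J$ is measurable with respect to the completion of the message distribution $\int\sigma(\cdot\mid\theta)\,d\mu_0(\theta)$; and $q(\cdot\mid m)$ is a Borel probability measure on $\Theta$ for each $m\in M$, such that: (i) for every $\theta$, $\sigma(\cdot\mid\theta)$ is supported on the maximizers of $\sum_j v(j)\tau(j\mid m)$ over $\{m\in M:\theta\in m\}$; (ii) for every $m\in M$,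 $\tau(\cdot\mid m)$ is supported on $\arg\max_j\int u(j,\theta)\,dq(\theta\mid m)$; (iii) $q$ is a regular conditional distribution of the state given the message under the joint law generated by $\mu_0$ and $\sigma$ (measurability in $m$ being understood up to null sets of the message distribution); (iv) $q(m\mid m)=1$ for every $m\in M$. **Outcomes.** An outcome is a Borel measurable $\alpha:\Theta\to\Delta J$. It is an equilibrium outcome if some equilibrium satisfies $\alpha(j\mid\theta)=\sum_m\tau(j\mid m)\sigma(m\mid\theta)$ for all $j,\theta$. It is deterministic if for every $\theta$ some $\alpha(j\mid\theta)=1$; its cells are then $W_j=\{\theta:\alpha(j\mid\theta)=1\}$. It satisfies IC at $\theta$ if $\sum_j v(j)\alpha(j\mid\theta)\ge\min\{v(j): u(j,\theta)\ge u(j',\theta)\ \forall j'\in J\}$, and it is IC if this holds at every $\theta\in\Theta$. It is obedient if $\int(u(j,\theta)-u(j',\theta))\,\alpha(j\mid\theta)\,d\mu_0(\theta)\ge 0$ for all $j,j'\in J$. A commitment outcome is an obedient outcome maximizing $\int\sum_j v(j)\alpha(j\mid\theta)\,d\mu_0(\theta)$ among all obedient outcomes. **Proposition.** A deterministic commitment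 outcome exists, and one exists all of whose nonempty cells have positive $\mu_0$-measure. Furthermore, for every deterministic commitment outcome $\alpha$: 1. if $\alpha$ is an equilibrium outcome, then $\alpha$ is IC; 2. if every nonempty cell of $\alpha$ has positive $\mu_0$-measure, then $\alpha$ is an equilibrium outcome if and only if it is IC; 3. without any condition on the cells, $\alpha$ coincides $\mu_0$-almost everywhere with an equilibrium outcome if and only if $\alpha$ satisfies IC at $\mu_0$-almost every $\theta$. -/

import Mathlib

open MeasureTheory
open scoped NNReal ENNReal

noncomputable section

namespace Persuasion

/-- A message is a nonempty Borel subset of the state space. -/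
structure Message (Θ : Type*) [MeasurableSpace Θ] where
  carrier : Set Θ
  nonempty : carrier.Nonempty
  measurable : MeasurableSet carrier

/-- Probability measures with finite support on `M`, given by their weights. -/
structure FinProb (M : Type*) where
  weight : M →₀ ℝ≥0
  sum_eq_one : (weight.sum fun _ x => x) = 1

/-- The measure on `M` with the given weights. -/
def FinProb.toMeasure {M : Type*} [MeasurableSpace M] (p : FinProb M) : Measure M :=
  p.weight.sum fun m x => x • Measure.dirac m

variable {Θ : Type*} [MeasurableSpace Θ] {K : ℕ}

/-- An outcome is a Borel measurable map from states to distributions over the actions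
`Fin K`; `α θ j` is the probability of action `j` in state `θ`. -/
structure Outcome (Θ : Type*) [MeasurableSpace Θ] (K : ℕ) where
  toFun : Θ → stdSimplex ℝ (Fin K)
  measurable : Measurable toFun

/-- The probability of action `j` in state `θ`. -/
def Outcome.prob (α : Outcome Θ K) (j : Fin K) (θ : Θ) : ℝ := (α.toFun θ).1 j

/-- In every state some action is taken with probability one. -/
def Outcome.IsDeterministic (α : Outcome Θ K) : Prop := ∀ θ, ∃ j, α.prob j θ = 1

/-- The set of states in which action `j` is taken with probability one. -/
def Outcome.cell (α : Outcome Θ K) (j : Fin K) : Set Θ := {θ | α.prob j θ = 1}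

/-- The sender's interim payoff. -/
def Outcome.interim (v : Fin K → ℝ) (α : Outcome Θ K) (θ : Θ) : ℝ := ∑ j, v j * α.prob j θ

/-- The sender's ex-ante utility. -/
def Outcome.exAnte (μ₀ : Measure Θ) (v : Fin K → ℝ) (α : Outcome Θ K) : ℝ :=
  ∫ θ, α.interim v θ ∂μ₀

/-- The set of states in which action `j` is optimal for the receiver under complete
information. -/
def completeInfoSet (u : Fin K → Θ → ℝ) (j : Fin K) : Set Θ := {θ | ∀ j', u j' θ ≤ u j θ}

/-- The sender's lowest complete-information payoff: the minimum of `v j` over the (finitely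
many, at least one) actions `j` that are optimal for the receiver at `θ`. -/
def lowestPayoff (v : Fin K → ℝ) (u : Fin K → Θ → ℝ) (θ : Θ) : ℝ :=
  sInf (v '' {j | θ ∈ completeInfoSet u j})

/-- The incentive constraint in state `θ`. -/
def Outcome.ICAt (v : Fin K → ℝ) (u : Fin K → Θ → ℝ) (α : Outcome Θ K) (θ : Θ) : Prop :=
  lowestPayoff v u θ ≤ α.interim v θ

/-- Incentive compatibility: the incentive constraint holds in every state. -/
def Outcome.IsIC (v : Fin K → ℝ) (u : Fin K → Θ → ℝ) (α : Outcome Θ K) : Prop :=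
  ∀ θ, α.ICAt v u θ

/-- Obedience of the receiver, for every recommended action `j`. -/
def Outcome.IsObedient (μ₀ : Measure Θ) (u : Fin K → Θ → ℝ) (α : Outcome Θ K) : Prop :=
  ∀ j j', 0 ≤ ∫ θ, (u j θ - u j' θ) * α.prob j θ ∂μ₀

/-- A commitment outcome is an obedient outcome that maximizes the sender's ex-ante utility
among all obedient outcomes. -/
def Outcome.IsCommitment (μ₀ : Measure Θ) (v : Fin K → ℝ) (u : Fin K → Θ → ℝ)
    (α : Outcome Θ K) : Prop :=
  α.IsObedient μ₀ u ∧ ∀ β : Outcome Θ K, β.IsObedient μ₀ u → β.exAnte μ₀ v ≤ α.exAnte μ₀ v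

/-- The sender's expected payoff from message `m` if the receiver plays `τ`. -/
def messagePayoff (v : Fin K → ℝ) (τ : Message Θ → stdSimplex ℝ (Fin K)) (m : Message Θ) : ℝ :=
  ∑ j, v j * (τ m).1 j

/-- The receiver's expected payoff from action `j` under the belief `ν`. -/
def beliefPayoff (u : Fin K → Θ → ℝ) (ν : ProbabilityMeasure Θ) (j : Fin K) : ℝ :=
  ∫ θ, u j θ ∂(ν : Measure Θ)

/-- The ex-ante distribution of messages under the sender's strategy `σ`. -/
def messageLaw [MeasurableSpace (Message Θ)] (μ₀ : Measure Θ) (σ : Θ → FinProb (Message Θ)) :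
    Measure (Message Θ) :=
  μ₀.bind fun θ => (σ θ).toMeasure

/-- The belief system `q` is a regular conditional distribution of the state given the message,
for the joint law of states and messages generated by the prior and by `σ`. For a
message `m` of positive probability this is Bayes' rule
`q(B | m) = ∫_B σ(m | θ) dμ₀(θ) / ∫ σ(m | θ) dμ₀(θ)`. -/
def IsBayesian [MeasurableSpace (Message Θ)] (μ₀ : Measure Θ) (σ : Θ → FinProb (Message Θ))
    (q : Message Θ → ProbabilityMeasure Θ) : Prop :=
  ∀ B : Set Θ, MeasurableSet B →
    AEMeasurable (fun m => (q m : Measure Θ) B) (messageLaw μ₀ σ) ∧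
    ∀ C : Set (Message Θ), MeasurableSet C →
      ∫⁻ m in C, (q m : Measure Θ) B ∂(messageLaw μ₀ σ) =
        ∫⁻ θ in B, (σ θ).toMeasure C ∂μ₀

/-- Perfect Bayesian equilibrium of the disclosure game. -/
structure IsEquilibrium [MeasurableSpace (Message Θ)] (μ₀ : Measure Θ) (v : Fin K → ℝ)
    (u : Fin K → Θ → ℝ) (σ : Θ → FinProb (Message Θ)) (τ : Message Θ → stdSimplex ℝ (Fin K))
    (q : Message Θ → ProbabilityMeasure Θ) : Prop where
  /-- The sender's strategy is measurable. -/
  sender_measurable : Measurable fun θ => (σ θ).toMeasure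
  /-- The receiver's strategy is measurable with respect to the distribution of messages. -/
  receiver_measurable : AEMeasurable τ (messageLaw μ₀ σ)
  /-- In every state the sender only sends messages that are optimal among the messages
  containing that state. -/
  sender_optimal : ∀ θ, ∀ m, (σ θ).weight m ≠ 0 →
    θ ∈ m.carrier ∧ ∀ m' : Message Θ, θ ∈ m'.carrier → messagePayoff v τ m' ≤ messagePayoff v τ m
  /-- After every message the receiver only takes actions that are optimal given her belief. -/
  receiver_optimal : ∀ m j, 0 < (τ m).1 j → ∀ j', beliefPayoff u (q m) j' ≤ beliefPayoff u (q m) j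
  /-- Beliefs are obtained by Bayes' rule. -/
  bayes : IsBayesian μ₀ σ q
  /-- Beliefs after `m` are concentrated on `m`. -/
  verifiable : ∀ m, (q m : Measure Θ) m.carrier = 1

/-- The outcome `α` is induced by the strategies `σ` and `τ`. -/
def Induces (σ : Θ → FinProb (Message Θ)) (τ : Message Θ → stdSimplex ℝ (Fin K))
    (α : Outcome Θ K) : Prop :=
  ∀ j θ, α.prob j θ = (σ θ).weight.sum fun m x => (x : ℝ) * (τ m).1 j

/-- The outcome `α` is induced by some equilibrium. -/
def Outcome.IsEquilibriumOutcome [MeasurableSpace (Message Θ)] (μ₀ : Measure Θ)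
    (v : Fin K → ℝ) (u : Fin K → Θ → ℝ) (α : Outcome Θ K) : Prop :=
  ∃ σ τ q, IsEquilibrium μ₀ v u σ τ q ∧ Induces σ τ α

/-- No action is taken with probability one only on a nonempty null set of states:
every nonempty cell has positive prior probability. -/
def Outcome.NoNullCell (μ₀ : Measure Θ) (α : Outcome Θ K) : Prop :=
  ∀ j, (α.cell j).Nonempty → 0 < μ₀ (α.cell j)

end Persuasion

end

/-! IC is necessary because a sender at `θ` can always disclose `{θ}`: the belief is then the point
mass at `θ`, and the receiver replies with an action optimal there
(`Outcome.IsEquilibriumOutcome.isIC`).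

Conversely, under a deterministic, obedient, IC rule let every state announce its own cell
(`Outcome.isEquilibriumOutcome_ofAction`). On a cell of positive measure, obedience says that the
recommended action is optimal against the conditional prior. Any message that is not a cell is met
with scepticism: the belief sits on a state of the message whose assigned action is lowest, and the
reply is the lowest action optimal at that state; by IC no state in the message gains. A null cell
is not governed by Bayes' rule or by obedience and needs some other supporting belief, which is why
null cells are excluded or repaired on a null set.

Existence is a linear program. Viewed as families of positive functionals on `L²`, outcomes form a
weak-* compact set, and the obedient maximizers have an extreme point. If it mixed two actions on a
set of positive measure, atomlessness would leave room for a nonzero shift of probability between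
them that is orthogonal to the finitely many functions in the objective and the constraints
(`exists_orthogonal_perturbation`). Shifting both ways would exhibit the extreme point as a midpoint
of other maximizers. -/

noncomputable section

namespace Persuasion

/-! ### Deterministic outcomes, incentive compatibility and equilibrium -/

section Game

variable {Θ : Type*} [MeasurableSpace Θ] {K : ℕ}

/-- The vertex of the simplex at `j`. -/
def vertex (j : Fin K) : stdSimplex ℝ (Fin K) := ⟨Pi.single j 1, single_mem_stdSimplex ℝ j⟩

lemma vertex_apply (i j : Fin K) : (vertex j).1 i = if i = j then 1 else 0 := by
  simp [vertex, Pi.single_apply]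

lemma sum_mul_vertex (v : Fin K → ℝ) (j : Fin K) : ∑ i, v i * (vertex j).1 i = v j := by
  simp [vertex_apply]

/-- The deterministic outcome given by an action for every state. -/
def Outcome.ofAction (a : Θ → Fin K) (ha : Measurable a) : Outcome Θ K where
  toFun θ := vertex (a θ)
  measurable := (measurable_of_finite vertex).comp ha

lemma Outcome.prob_ofAction (a : Θ → Fin K) (ha : Measurable a) (j : Fin K) (θ : Θ) :
    (ofAction a ha).prob j θ = if j = a θ then 1 else 0 :=
  vertex_apply j (a θ)

lemma Outcome.interim_ofAction (v : Fin K → ℝ) (a : Θ → Fin K) (ha : Measurable a) (θ : Θ) :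
    (ofAction a ha).interim v θ = v (a θ) :=
  sum_mul_vertex v (a θ)

lemma Outcome.cell_ofAction (a : Θ → Fin K) (ha : Measurable a) (j : Fin K) :
    (ofAction a ha).cell j = a ⁻¹' {j} := by
  ext θ
  simp [cell, prob_ofAction, eq_comm]

lemma Outcome.isDeterministic_ofAction (a : Θ → Fin K) (ha : Measurable a) :
    (ofAction a ha).IsDeterministic := fun θ => ⟨a θ, by simp [prob_ofAction]⟩

lemma Outcome.measurable_prob (α : Outcome Θ K) (j : Fin K) : Measurable (α.prob j) :=
  (measurable_pi_apply j).comp (measurable_subtype_coe.comp α.measurable)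

lemma Outcome.prob_nonneg (α : Outcome Θ K) (j : Fin K) (θ : Θ) : 0 ≤ α.prob j θ :=
  (α.toFun θ).2.1 j

lemma Outcome.sum_prob (α : Outcome Θ K) (θ : Θ) : ∑ j, α.prob j θ = 1 :=
  (α.toFun θ).2.2

lemma Outcome.prob_le_one (α : Outcome Θ K) (j : Fin K) (θ : Θ) : α.prob j θ ≤ 1 :=
  (α.sum_prob θ) ▸ Finset.single_le_sum (fun i _ => α.prob_nonneg i θ) (Finset.mem_univ j)

lemma eq_vertex_of_apply_eq_one (x : stdSimplex ℝ (Fin K)) (j : Fin K) (h : x.1 j = 1) :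
    x = vertex j := by
  apply Subtype.ext
  funext i
  rw [vertex_apply]
  split_ifs with hij
  · rw [hij, h]
  · have h1 := x.2.2
    rw [← Finset.add_sum_erase _ _ (Finset.mem_univ j), h] at h1
    have h2 : ∑ k ∈ Finset.univ.erase j, x.1 k = 0 := by
      linarith
    exact (Finset.sum_eq_zero_iff_of_nonneg fun k _ => x.2.1 k).1 h2 i
      (Finset.mem_erase.2 ⟨hij, Finset.mem_univ i⟩)

lemma Outcome.IsDeterministic.exists_eq_ofAction {α : Outcome Θ K} (h : α.IsDeterministic) :
    ∃ a ha, α = ofAction a ha := by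
  choose a ha using h
  have hav : ∀ θ, α.toFun θ = vertex (a θ) := fun θ => eq_vertex_of_apply_eq_one _ _ (ha θ)
  have hm : Measurable a := by
    refine measurable_to_countable' fun j => ?_
    have : a ⁻¹' {j} = α.prob j ⁻¹' {1} := by
      ext θ
      have : α.prob j θ = if j = a θ then 1 else 0 := by
        rw [← vertex_apply, ← hav]; rfl
      simp [this, eq_comm]
    rw [this]
    exact α.measurable_prob j (measurableSet_singleton 1)
  refine ⟨a, hm, ?_⟩
  cases α
  congr
  exact funext hav

omit [MeasurableSpace Θ] in
lemma completeInfoSet_nonempty [NeZero K] (u : Fin K → Θ → ℝ) (θ : Θ) :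
    {j | θ ∈ completeInfoSet u j}.Nonempty := by
  obtain ⟨j, hj⟩ := Finite.exists_max fun j => u j θ
  exact ⟨j, hj⟩

omit [MeasurableSpace Θ] in
lemma lowestPayoff_le (v : Fin K → ℝ) {u : Fin K → Θ → ℝ} {θ : Θ} {j : Fin K}
    (h : θ ∈ completeInfoSet u j) : lowestPayoff v u θ ≤ v j :=
  csInf_le (Set.toFinite _).bddBelow ⟨j, h, rfl⟩

lemma measurableSet_completeInfoSet {u : Fin K → Θ → ℝ} (hu : ∀ j, Measurable (u j)) (j : Fin K) :
    MeasurableSet (completeInfoSet u j) := by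
  have : completeInfoSet u j = ⋂ j', {θ | u j' θ ≤ u j θ} := by
    ext; simp [completeInfoSet]
  rw [this]
  exact .iInter fun j' => measurableSet_le (hu j') (hu j)

/-- There is a measurable selection of the lowest optimal action. -/
lemma exists_measurable_lowest_action [NeZero K] {v : Fin K → ℝ} (hv : StrictMono v)
    {u : Fin K → Θ → ℝ} (hu : ∀ j, Measurable (u j)) :
    ∃ a : Θ → Fin K, Measurable a ∧ (∀ θ, θ ∈ completeInfoSet u (a θ)) ∧
      ∀ θ, v (a θ) = lowestPayoff v u θ := by
  have h : ∀ θ, ∃ j, θ ∈ completeInfoSet u j ∧ ∀ i, θ ∈ completeInfoSet u i → j ≤ i := fun θ => by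
    obtain ⟨j, hj⟩ := Set.exists_min_image {j | θ ∈ completeInfoSet u j} id (Set.toFinite _)
      (completeInfoSet_nonempty u θ)
    exact ⟨j, hj.1, hj.2⟩
  choose a ha hmin using h
  refine ⟨a, measurable_to_countable' fun j => ?_, ha, fun θ => ?_⟩
  · have : a ⁻¹' {j} = completeInfoSet u j ∩ ⋂ i, ⋂ (_ : i < j), (completeInfoSet u i)ᶜ := by
      ext θ
      simp only [Set.mem_preimage, Set.mem_singleton_iff, Set.mem_inter_iff, Set.mem_iInter,
        Set.mem_compl_iff]
      constructor
      · rintro rfl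
        exact ⟨ha θ, fun i hi h' => (hmin θ i h').not_gt hi⟩
      · rintro ⟨h1, h2⟩
        exact le_antisymm (hmin θ j h1) (not_lt.1 fun hlt => h2 _ hlt (ha θ))
    rw [this]
    exact (measurableSet_completeInfoSet hu j).inter
      (.iInter fun i => .iInter fun _ => (measurableSet_completeInfoSet hu i).compl)
  · refine le_antisymm (le_csInf ((completeInfoSet_nonempty u θ).image v) ?_)
      (lowestPayoff_le v (ha θ))
    rintro _ ⟨i, hi, rfl⟩
    exact hv.monotone (hmin θ i hi)

lemma FinProb.sum_mul_le {M : Type*} (p : FinProb M) (f : M → ℝ) (c : ℝ)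
    (h : ∀ m, p.weight m ≠ 0 → c ≤ f m) : c ≤ p.weight.sum fun m x => (x : ℝ) * f m := by
  have h1 : (p.weight.sum fun _ x => (x : ℝ)) = 1 := by
    have := congrArg ((↑) : ℝ≥0 → ℝ) p.sum_eq_one
    simpa [Finsupp.sum] using this
  calc c = (p.weight.sum fun _ x => (x : ℝ)) * c := by rw [h1, one_mul]
    _ ≤ _ := by
      rw [Finsupp.sum, Finsupp.sum, Finset.sum_mul]
      exact Finset.sum_le_sum fun m hm =>
        mul_le_mul_of_nonneg_left (h m (Finsupp.mem_support_iff.1 hm)) (p.weight m).2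

lemma Induces.interim_eq {σ : Θ → FinProb (Message Θ)} {τ : Message Θ → stdSimplex ℝ (Fin K)}
    {α : Outcome Θ K} (h : Induces σ τ α) (v : Fin K → ℝ) (θ : Θ) :
    α.interim v θ = (σ θ).weight.sum fun m x => (x : ℝ) * messagePayoff v τ m := by
  simp only [Outcome.interim, h _ θ, Finsupp.sum, messagePayoff, Finset.mul_sum]
  rw [Finset.sum_comm]
  exact Finset.sum_congr rfl fun _ _ => Finset.sum_congr rfl fun _ _ => by ring

lemma le_messagePayoff {v : Fin K → ℝ} {τ : Message Θ → stdSimplex ℝ (Fin K)} {m : Message Θ}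
    {c : ℝ} (h : ∀ j, 0 < (τ m).1 j → c ≤ v j) : c ≤ messagePayoff v τ m := by
  calc c = ∑ j, c * (τ m).1 j := by rw [← Finset.mul_sum, (τ m).2.2, mul_one]
    _ ≤ _ := Finset.sum_le_sum fun j _ => by
      rcases ((τ m).2.1 j).eq_or_lt with h0 | h0
      · rw [← h0]; simp
      · exact mul_le_mul_of_nonneg_right (h j h0) h0.le

/-- The state `θ` can be disclosed, after which the receiver takes an action that is optimal
at `θ`. -/
theorem Outcome.IsEquilibriumOutcome.isIC [MeasurableSingletonClass Θ]
    [MeasurableSpace (Message Θ)] {μ₀ : Measure Θ} {v : Fin K → ℝ} {u : Fin K → Θ → ℝ}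
    {α : Outcome Θ K} (h : α.IsEquilibriumOutcome μ₀ v u) : α.IsIC v u := by
  obtain ⟨σ, τ, q, heq, hind⟩ := h
  intro θ
  let m₀ : Message Θ := ⟨{θ}, Set.singleton_nonempty θ, measurableSet_singleton θ⟩
  have hq : ∀ j, beliefPayoff u (q m₀) j = u j θ := fun j => by
    have hae : ∀ᵐ x ∂(q m₀ : Measure Θ), x = θ := by
      have := heq.verifiable m₀
      rw [← prob_compl_eq_zero_iff m₀.measurable] at this
      exact this
    have : ∫ x, u j x ∂(q m₀ : Measure Θ) = ∫ _, u j θ ∂(q m₀ : Measure Θ) :=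
      integral_congr_ae (hae.mono fun x hx => by rw [hx])
    rw [beliefPayoff, this]
    simp
  have hlow : lowestPayoff v u θ ≤ messagePayoff v τ m₀ := le_messagePayoff fun j hj =>
    lowestPayoff_le v fun j' => by
      have := heq.receiver_optimal m₀ j hj j'
      rwa [hq, hq] at this
  rw [ICAt, hind.interim_eq]
  exact FinProb.sum_mul_le _ _ _ fun m hm =>
    hlow.trans ((heq.sender_optimal θ m hm).2 m₀ rfl)

/-- The degenerate distribution. -/
def FinProb.pure {M : Type*} (m : M) : FinProb M where
  weight := Finsupp.single m 1
  sum_eq_one := by simp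

lemma FinProb.toMeasure_pure {M : Type*} [MeasurableSpace M] (m : M) :
    (FinProb.pure m).toMeasure = Measure.dirac m := by
  simp [FinProb.pure, FinProb.toMeasure]

/-- The σ-algebra on messages is only assumed to contain the singletons, and replies and beliefs are
chosen message by message. Since finitely many messages are sent, any such choice agrees almost
everywhere with a measurable one. -/
lemma aemeasurable_map_of_finite_range {M X : Type*} [MeasurableSpace M]
    [MeasurableSingletonClass M] [MeasurableSpace X] {μ : Measure Θ} {Φ : Θ → M} (hfin : (Set.range Φ).Finite) (f : M → X) :
    AEMeasurable f (μ.map Φ) := by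
  classical
  rcases isEmpty_or_nonempty Θ with hΘ | ⟨⟨θ₀⟩⟩
  · rw [Measure.eq_zero_of_isEmpty μ]
    simp
  refine ⟨(Set.range Φ).piecewise f fun _ => f (Φ θ₀), fun t ht => ?_, ?_⟩
  · rw [Set.piecewise_preimage, Set.ite]
    exact (hfin.subset Set.inter_subset_right).measurableSet.union
      ((measurable_const ht).diff hfin.measurableSet)
  · filter_upwards [ae_map_mem_range Φ hfin.measurableSet μ] with m hm
    exact (Set.piecewise_eq_of_mem _ _ _ hm).symm

lemma setLIntegral_eq_sum_fiber {μ : Measure Θ} {a : Θ → Fin K} (ha : Measurable a)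
    (f : Θ → ℝ≥0∞) {D : Set Θ} (hD : MeasurableSet D) :
    ∫⁻ θ in D, f θ ∂μ = ∑ j, ∫⁻ θ in a ⁻¹' {j} ∩ D, f θ ∂μ := by
  have hU : D = ⋃ j, a ⁻¹' {j} ∩ D := by
    ext θ; simp
  conv_lhs => rw [hU]
  rw [lintegral_iUnion (fun j => (ha (measurableSet_singleton j)).inter hD), tsum_fintype]
  intro i j hij
  refine Set.disjoint_left.2 fun θ h1 h2 => hij ?_
  rw [← show a θ = i from h1.1, ← show a θ = j from h2.1]

lemma integrable_of_bounded {μ : Measure Θ} [IsFiniteMeasure μ] {f : Θ → ℝ} (hf : Measurable f)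
    {C : ℝ} (h : ∀ θ, |f θ| ≤ C) : Integrable f μ :=
  Integrable.of_bound hf.aestronglyMeasurable C (.of_forall h)

lemma Outcome.isObedient_ofAction_iff {μ₀ : Measure Θ} {u : Fin K → Θ → ℝ} {a : Θ → Fin K}
    (ha : Measurable a) : (ofAction a ha).IsObedient μ₀ u ↔
      ∀ j j', 0 ≤ ∫ θ in a ⁻¹' {j}, (u j θ - u j' θ) ∂μ₀ := by
  refine forall₂_congr fun j j' => ?_
  rw [← integral_indicator (ha (measurableSet_singleton j))]
  congr! 2
  funext θ
  by_cases h : a θ = j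
  · simp [prob_ofAction, h]
  · simp [prob_ofAction, h, Ne.symm h]

/-- The equilibrium in which every state sends the cell that contains it. -/
theorem Outcome.isEquilibriumOutcome_ofAction [MeasurableSpace (Message Θ)]
    [MeasurableSingletonClass (Message Θ)] [NeZero K]
    {μ₀ : Measure Θ} [IsProbabilityMeasure μ₀] {v : Fin K → ℝ} (hv : StrictMono v)
    {u : Fin K → Θ → ℝ} (hu : ∀ j, Measurable (u j)) (hbdd : ∃ C : ℝ, ∀ j θ, |u j θ| ≤ C)
    {a : Θ → Fin K} (ha : Measurable a) (hob : (ofAction a ha).IsObedient μ₀ u)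
    (hIC : (ofAction a ha).IsIC v u)
    (hcell : ∀ j, (a ⁻¹' {j}).Nonempty →
      0 < μ₀ (a ⁻¹' {j}) ∨ ∃ θ ∈ a ⁻¹' {j}, θ ∈ completeInfoSet u j) :
    (ofAction a ha).IsEquilibriumOutcome μ₀ v u := by
  obtain ⟨C, hC⟩ := hbdd
  have hint : ∀ (ν : Measure Θ) [IsFiniteMeasure ν] j, Integrable (u j) ν := fun ν _ j =>
    integrable_of_bounded (hu j) (hC j)
  have hms : ∀ j, MeasurableSet (a ⁻¹' {j}) := fun j => ha (measurableSet_singleton j)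
  simp only [IsIC, ICAt, interim_ofAction] at hIC
  rw [isObedient_ofAction_iff] at hob
  obtain ⟨b, -, hbopt, hbv⟩ := exists_measurable_lowest_action hv hu
  let Φ : Θ → Message Θ := fun θ => ⟨a ⁻¹' {a θ}, ⟨θ, rfl⟩, hms _⟩
  have hΦa : ∀ {θ θ'}, a θ = a θ' → Φ θ = Φ θ' := fun {θ θ'} h => by simp [Φ, h]
  have haΦ : ∀ {θ θ'}, θ ∈ (Φ θ').carrier → a θ = a θ' := fun h => h
  -- `Φ` factors through the finite-valued `a`, so even an arbitrary set of messages has a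
  -- measurable preimage.
  have hΦm : Measurable Φ := fun C _ => by
    have : Φ ⁻¹' C = a ⁻¹' {j | ∃ θ, a θ = j ∧ Φ θ ∈ C} := by
      ext θ
      exact ⟨fun h => ⟨θ, rfl, h⟩, fun ⟨θ', h1, h2⟩ => by rwa [Set.mem_preimage, ← hΦa h1]⟩
    rw [this]
    exact ha (Set.toFinite _).measurableSet
  have hΦfin : (Set.range Φ).Finite := by
    refine Set.Finite.of_finite_image (f := Message.carrier)
      ((Set.finite_range fun j => a ⁻¹' {j}).subset ?_) ?_
    · rintro _ ⟨_, ⟨θ, rfl⟩, rfl⟩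
      exact ⟨a θ, rfl⟩
    · rintro ⟨_, _, _⟩ _ ⟨_, _, _⟩ _ rfl
      rfl
  -- Reply and belief for each message. The third clause deters deviations; the fourth fixes play
  -- and Bayesian beliefs on the path.
  have key : ∀ m : Message Θ, ∃ (j : Fin K) (ν : ProbabilityMeasure Θ),
      (ν : Measure Θ) m.carrier = 1 ∧ (∀ j', beliefPayoff u ν j' ≤ beliefPayoff u ν j) ∧
      (∀ θ ∈ m.carrier, v j ≤ v (a θ)) ∧
      ∀ θ, m = Φ θ → j = a θ ∧ (0 < μ₀ m.carrier →
        (ν : Measure Θ) = ProbabilityTheory.cond μ₀ m.carrier) := by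
    have hdirac : ∀ θ j, beliefPayoff u ⟨Measure.dirac θ, inferInstance⟩ j = u j θ := fun θ j => by
      exact integral_dirac' _ _ (hu j).stronglyMeasurable
    intro m
    by_cases hm : ∃ θ, m = Φ θ
    · obtain ⟨θ, rfl⟩ := hm
      by_cases hpos : 0 < μ₀ (Φ θ).carrier
      · refine ⟨a θ, ⟨ProbabilityTheory.cond μ₀ (Φ θ).carrier,
          ProbabilityTheory.cond_isProbabilityMeasure hpos.ne'⟩, ?_, ?_, ?_, ?_⟩
        · exact ProbabilityTheory.cond_apply_self hpos.ne' (measure_ne_top _ _)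
        · intro j'
          -- Conditioning only rescales the integrals over the cell, so optimality reduces to
          -- obedience.
          simp only [beliefPayoff, ProbabilityMeasure.coe_mk, ProbabilityTheory.cond,
            integral_smul_measure]
          refine smul_le_smul_of_nonneg_left ?_ ENNReal.toReal_nonneg
          have := hob (a θ) j'
          rwa [integral_sub (hint _ _) (hint _ _), sub_nonneg] at this
        · exact fun θ' h => by rw [haΦ h]
        · exact fun θ' h => ⟨haΦ (h ▸ rfl : θ ∈ (Φ θ').carrier), fun _ => rfl⟩
      -- On a null cell Bayes' rule is silent, so the belief may be placed on a state where the
      -- cell's action is optimal.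
      · obtain ⟨θ₁, h1, h2⟩ := (hcell (a θ) ⟨θ, rfl⟩).resolve_left hpos
        refine ⟨a θ, ⟨Measure.dirac θ₁, inferInstance⟩, ?_, ?_, ?_, ?_⟩
        · exact Measure.dirac_apply_of_mem h1
        · intro j'
          rw [hdirac, hdirac]
          exact h2 j'
        · exact fun θ' h => by rw [haΦ h]
        · exact fun θ' h => ⟨haΦ (h ▸ rfl : θ ∈ (Φ θ').carrier), fun h => absurd h hpos⟩
    -- Sceptical belief off the path: `θ` has the lowest assigned action in the message, and IC at
    -- `θ` bounds the value of the reply `b θ` by `v (a θ)`.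
    · obtain ⟨_, ⟨θ, hθ, rfl⟩, hmin⟩ := Set.exists_min_image (a '' m.carrier) id (Set.toFinite _)
        (m.nonempty.image a)
      refine ⟨b θ, ⟨Measure.dirac θ, inferInstance⟩, ?_, ?_, ?_, ?_⟩
      · exact Measure.dirac_apply_of_mem hθ
      · intro j'
        rw [hdirac, hdirac]
        exact hbopt θ j'
      · intro θ' h
        rw [hbv]
        exact (hIC θ).trans (hv.monotone (hmin _ ⟨θ', h, rfl⟩))
      · exact fun θ' h => absurd ⟨θ', h⟩ hm
  choose t q hq1 hqopt htv hon using key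
  have htΦ : ∀ θ, t (Φ θ) = a θ := fun θ => (hon _ θ rfl).1
  have hlaw : messageLaw μ₀ (fun θ => FinProb.pure (Φ θ)) = μ₀.map Φ := by
    simp only [messageLaw, FinProb.toMeasure_pure]
    exact Measure.bind_dirac_eq_map μ₀ hΦm
  have hpay : ∀ m, messagePayoff v (fun m => vertex (t m)) m = v (t m) := fun m =>
    sum_mul_vertex v (t m)
  refine ⟨fun θ => FinProb.pure (Φ θ), fun m => vertex (t m), q, ?_, ?_⟩
  · refine ⟨?_, ?_, ?_, ?_, ?_, hq1⟩
    · simp only [FinProb.toMeasure_pure]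
      exact Measure.measurable_dirac.comp hΦm
    · rw [hlaw]
      exact aemeasurable_map_of_finite_range hΦfin _
    · intro θ m hm
      obtain rfl : Φ θ = m := by
        by_contra hne
        exact hm (Finsupp.single_eq_of_ne' hne)
      refine ⟨rfl, fun m' hm' => ?_⟩
      rw [hpay, hpay, htΦ]
      exact htv m' θ hm'
    · intro m j hj
      obtain rfl : j = t m := by
        by_contra hne
        simp [vertex_apply, hne] at hj
      exact hqopt m
    · intro B hB
      rw [hlaw]
      have hAE : AEMeasurable (fun m => (q m : Measure Θ) B) (μ₀.map Φ) :=
        aemeasurable_map_of_finite_range hΦfin _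
      refine ⟨hAE, fun C hC => ?_⟩
      simp only [FinProb.toMeasure_pure]
      -- As `Φ` is constant on each cell, it suffices to compare the two sides cell by cell. For a
      -- cell in `C` this says that `q B` times the mass of the cell is the mass of its intersection
      -- with `B`; on null cells both sides vanish.
      rw [← lintegral_indicator hC, lintegral_map' (hAE.indicator hC) hΦm.aemeasurable,
        ← setLIntegral_univ, setLIntegral_eq_sum_fiber ha _ MeasurableSet.univ,
        setLIntegral_eq_sum_fiber ha _ hB]
      refine Finset.sum_congr rfl fun j _ => ?_
      rw [Set.inter_univ]
      rcases (a ⁻¹' {j}).eq_empty_or_nonempty with h0 | ⟨θ₀, rfl⟩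
      · simp [h0]
      have h1 : ∫⁻ θ in a ⁻¹' {a θ₀}, C.indicator (fun m => (q m : Measure Θ) B) (Φ θ) ∂μ₀ =
          ∫⁻ θ in a ⁻¹' {a θ₀}, C.indicator (fun m => (q m : Measure Θ) B) (Φ θ₀) ∂μ₀ :=
        setLIntegral_congr_fun (hms _) fun θ hθ => by rw [hΦa hθ]
      have h2 : ∫⁻ θ in a ⁻¹' {a θ₀} ∩ B, Measure.dirac (Φ θ) C ∂μ₀ =
          ∫⁻ θ in a ⁻¹' {a θ₀} ∩ B, Measure.dirac (Φ θ₀) C ∂μ₀ :=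
        setLIntegral_congr_fun ((hms _).inter hB) fun θ hθ => by
          rw [hΦa (show a θ = a θ₀ from hθ.1)]
      rw [h1, h2, setLIntegral_const, setLIntegral_const, Measure.dirac_apply' _ hC]
      by_cases hmem : Φ θ₀ ∈ C
      · rw [Set.indicator_of_mem hmem, Set.indicator_of_mem hmem, Pi.one_apply, one_mul]
        by_cases hpos : 0 < μ₀ (a ⁻¹' {a θ₀})
        · rw [(hon _ θ₀ rfl).2 hpos, ProbabilityTheory.cond_apply (Φ θ₀).measurable, mul_comm,
            ← mul_assoc, ENNReal.mul_inv_cancel hpos.ne' (measure_ne_top _ _), one_mul]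
        · have hz : μ₀ (a ⁻¹' {a θ₀}) = 0 := le_antisymm (not_lt.1 hpos) (zero_le)
          rw [hz, mul_zero, measure_mono_null Set.inter_subset_left hz]
      · simp [hmem]
  · intro j θ
    rw [prob_ofAction]
    simp [FinProb.pure, htΦ, vertex_apply]

lemma Outcome.IsObedient.congr_ae {μ₀ : Measure Θ} {u : Fin K → Θ → ℝ} {α β : Outcome Θ K}
    (h : ∀ᵐ θ ∂μ₀, β.toFun θ = α.toFun θ) (hα : α.IsObedient μ₀ u) : β.IsObedient μ₀ u := by
  intro j j'
  rw [integral_congr_ae (g := fun θ => (u j θ - u j' θ) * α.prob j θ)]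
  · exact hα j j'
  · filter_upwards [h] with θ hθ
    rw [prob, prob, hθ]

lemma Outcome.exAnte_congr_ae {μ₀ : Measure Θ} {v : Fin K → ℝ} {α β : Outcome Θ K}
    (h : ∀ᵐ θ ∂μ₀, β.toFun θ = α.toFun θ) : β.exAnte μ₀ v = α.exAnte μ₀ v := by
  refine integral_congr_ae (h.mono fun θ hθ => ?_)
  simp only [interim, prob, hθ]

/-- The states in null cells of an action rule form a null set. -/
lemma measure_null_cells (μ : Measure Θ) (a : Θ → Fin K) :
    μ {θ | μ (a ⁻¹' {a θ}) = 0} = 0 := by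
  have : {θ | μ (a ⁻¹' {a θ}) = 0} = ⋃ j : {j // μ (a ⁻¹' {j}) = 0}, a ⁻¹' {j.1} := by
    ext θ; simp
  rw [this]
  exact measure_iUnion_null fun j => j.2

/-- States that violate the incentive constraint and states in null cells may be reassigned
their lowest optimal action. -/
theorem Outcome.exists_isEquilibriumOutcome_ae_eq [MeasurableSpace (Message Θ)]
    [MeasurableSingletonClass (Message Θ)] [NeZero K]
    {μ₀ : Measure Θ} [IsProbabilityMeasure μ₀] {v : Fin K → ℝ} (hv : StrictMono v)
    {u : Fin K → Θ → ℝ} (hu : ∀ j, Measurable (u j)) (hbdd : ∃ C : ℝ, ∀ j θ, |u j θ| ≤ C)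
    {α : Outcome Θ K} (hdet : α.IsDeterministic) (hob : α.IsObedient μ₀ u)
    (hIC : ∀ᵐ θ ∂μ₀, α.ICAt v u θ) :
    ∃ β : Outcome Θ K, β.IsEquilibriumOutcome μ₀ v u ∧ ∀ᵐ θ ∂μ₀, β.toFun θ = α.toFun θ := by
  classical
  obtain ⟨a, ha, rfl⟩ := hdet.exists_eq_ofAction
  obtain ⟨b, hb, hbopt, hbv⟩ := exists_measurable_lowest_action hv hu
  simp only [ICAt, interim_ofAction] at hIC
  let N : Set Θ := {θ | v (a θ) < v (b θ)} ∪ {θ | μ₀ (a ⁻¹' {a θ}) = 0}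
  have hN : MeasurableSet N :=
    (measurableSet_lt ((measurable_of_finite v).comp ha) ((measurable_of_finite v).comp hb)).union
      (ha (Set.toFinite {j | μ₀ (a ⁻¹' {j}) = 0}).measurableSet)
  have hN0 : μ₀ N = 0 := by
    refine measure_union_null ?_ (measure_null_cells μ₀ a)
    refine measure_mono_null (fun θ hθ => ?_) hIC
    rw [Set.mem_compl_iff, Set.mem_ofPred_eq, not_le, ← hbv]
    exact hθ
  let c : Θ → Fin K := N.piecewise b a
  have hc : Measurable c := hb.piecewise hN ha
  have hae : ∀ᵐ θ ∂μ₀, (ofAction c hc).toFun θ = (ofAction a ha).toFun θ := by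
    filter_upwards [measure_eq_zero_iff_ae_notMem.1 hN0] with θ hθ
    simp [ofAction, c, hθ]
  refine ⟨ofAction c hc, isEquilibriumOutcome_ofAction hv hu hbdd hc (hob.congr_ae hae) ?_ ?_, hae⟩
  · intro θ
    rw [ICAt, interim_ofAction, ← hbv]
    by_cases h : θ ∈ N
    · simp [c, h]
    · simp only [c, h, not_false_eq_true, Set.piecewise_eq_of_notMem]
      exact not_lt.1 fun h' => h (Or.inl h')
  -- If `θ` was reassigned, its new action is optimal at `θ` itself; otherwise its new cell agrees,
  -- up to a null set, with an old cell of positive measure.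
  · rintro j ⟨θ, rfl⟩
    by_cases h : θ ∈ N
    · refine Or.inr ⟨θ, rfl, ?_⟩
      rw [show c θ = b θ by simp [c, h]]
      exact hbopt θ
    · left
      have hca : c θ = a θ := by simp [c, h]
      have hpos : μ₀ (a ⁻¹' {a θ}) ≠ 0 := fun h' => h (Or.inr h')
      have : μ₀ (c ⁻¹' {c θ}) = μ₀ (a ⁻¹' {a θ}) := by
        refine measure_congr ?_
        rw [hca]
        filter_upwards [measure_eq_zero_iff_ae_notMem.1 hN0] with θ' hθ'
        apply propext
        change c θ' = a θ ↔ a θ' = a θ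
        rw [show c θ' = a θ' by simp [c, hθ']]
      rw [this]
      exact pos_iff_ne_zero.2 hpos

end Game

/-! ### Perturbations under an atomless measure -/

section Splitting

variable {Θ : Type*} [MeasurableSpace Θ] [TopologicalSpace Θ] [T2Space Θ]
  [HereditarilyLindelofSpace Θ] [OpensMeasurableSpace Θ]

/-- A set of positive measure contains arbitrarily many disjoint sets of positive measure, if
points are null. -/
lemma exists_disjoint_subsets_of_measure_pos (μ : Measure Θ) [NullSingletonClass μ] {A : Set Θ}
    (hA : MeasurableSet A) (hpos : 0 < μ A) (N : ℕ) :
    ∃ s : Fin N → Set Θ, Pairwise (Function.onFun Disjoint s) ∧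
      ∀ k, MeasurableSet (s k) ∧ s k ⊆ A ∧ 0 < μ (s k) := by
  -- A finite support would be null, and the complement of the support is always null here. Disjoint
  -- neighbourhoods of support points then meet `A` in positive measure.
  have hinf : (μ.restrict A).support.Infinite := fun hfin => by
    have h0 : (μ.restrict A) Set.univ = 0 := by
      rw [← Set.union_compl_self (μ.restrict A).support]
      exact measure_union_null (hfin.measure_zero _) Measure.measure_compl_support
    rw [Measure.restrict_apply_univ] at h0
    exact hpos.ne' h0
  obtain ⟨t, hts, htN⟩ := hinf.exists_subset_card_eq N
  obtain ⟨U, hU, hdisj⟩ := t.finite_toSet.t2_separation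
  let e := t.equivFinOfCardEq htN
  refine ⟨fun k => U (e.symm k) ∩ A, fun k l hkl => ?_, fun k => ⟨?_, Set.inter_subset_right, ?_⟩⟩
  · exact (hdisj (e.symm k).2 (e.symm l).2 fun h =>
      hkl (e.symm.injective (Subtype.ext h))).mono Set.inter_subset_left Set.inter_subset_left
  · exact (hU _).2.measurableSet.inter hA
  · rw [← Measure.restrict_apply (hU _).2.measurableSet]
    exact (Measure.mem_support_iff_forall _).1 (hts (e.symm k).2) _ ((hU _).2.mem_nhds (hU _).1)

/-- A small nonzero function on `A` that is orthogonal to finitely many given functions. -/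
lemma exists_orthogonal_perturbation (μ : Measure Θ) [NullSingletonClass μ] {A : Set Θ}
    (hA : MeasurableSet A) (hpos : 0 < μ A) {ι : Type*} [Fintype ι] {f : ι → Θ → ℝ}
    (hf : ∀ i, Integrable (f i) μ) {ε : ℝ} (hε : 0 < ε) :
    ∃ h : Θ → ℝ, Measurable h ∧ (∀ θ, |h θ| ≤ ε) ∧ (∀ θ, θ ∉ A → h θ = 0) ∧
      (∀ i, ∫ θ, f i θ * h θ ∂μ = 0) ∧ ¬ h =ᵐ[μ] 0 := by
  classical
  -- One more piece than there are equations, so some nonzero choice of constants on the pieces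
  -- solves all of them.
  obtain ⟨s, hdisj, hs⟩ := exists_disjoint_subsets_of_measure_pos μ hA hpos (Fintype.card ι + 1)
  let T := Fintype.linearCombination ℝ fun (k : Fin (Fintype.card ι + 1)) i => ∫ θ in s k, f i θ ∂μ
  obtain ⟨c, hcT, hc⟩ := (Submodule.ne_bot_iff _).1
    (LinearMap.ker_ne_bot_of_finrank_lt (f := T) (by simp))
  have hC : 0 < ∑ k, |c k| := by
    obtain ⟨k, hk⟩ := Function.ne_iff.1 hc
    exact Finset.sum_pos' (fun _ _ => abs_nonneg _) ⟨k, Finset.mem_univ k, abs_pos.2 hk⟩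
  let g : Θ → ℝ := fun θ => ∑ k, (s k).indicator (fun _ => c k) θ
  have hgm : Measurable g :=
    Finset.measurable_sum _ fun k _ => measurable_const.indicator (hs k).1
  have hgb : ∀ θ, |g θ| ≤ ∑ k, |c k| := fun θ =>
    (Finset.abs_sum_le_sum_abs _ _).trans (Finset.sum_le_sum fun k _ => by
      by_cases h : θ ∈ s k <;> simp [h])
  have hgs : ∀ k, ∀ θ ∈ s k, g θ = c k := fun k θ hθ => by
    rw [← Set.indicator_of_mem hθ fun _ => c k]
    refine Finset.sum_eq_single k (fun l _ hl => Set.indicator_of_notMem (fun h => ?_) _) (by simp)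
    exact Set.disjoint_left.1 (hdisj hl) h hθ
  refine ⟨fun θ => ε / (∑ k, |c k|) * g θ, hgm.const_mul _, fun θ => ?_, fun θ hθ => ?_,
    fun i => ?_, fun h0 => ?_⟩
  · rw [abs_mul, abs_of_pos (div_pos hε hC), div_mul_eq_mul_div, div_le_iff₀ hC]
    exact mul_le_mul_of_nonneg_left (hgb θ) hε.le
  · have : g θ = 0 := Finset.sum_eq_zero fun k _ =>
      Set.indicator_of_notMem (fun h => hθ ((hs k).2.1 h)) _
    simp only [this, mul_zero]
  · have hT := congrFun (LinearMap.mem_ker.1 hcT) i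
    simp only [T, Fintype.linearCombination_apply, Finset.sum_apply, Pi.smul_apply, smul_eq_mul,
      Pi.zero_apply] at hT
    have : ∀ θ, f i θ * (ε / (∑ k, |c k|) * g θ) =
        ε / (∑ k, |c k|) * ∑ k, c k * (s k).indicator (f i) θ := fun θ => by
      rw [mul_left_comm, Finset.mul_sum]
      congr 1
      refine Finset.sum_congr rfl fun k _ => ?_
      by_cases h : θ ∈ s k <;> simp [h, mul_comm]
    simp_rw [this]
    rw [integral_const_mul, integral_finsetSum _ fun k _ =>
      ((hf i).indicator (hs k).1).const_mul _]
    simp_rw [integral_const_mul, integral_indicator (hs _).1]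
    rw [hT, mul_zero]
  · obtain ⟨k, hk⟩ := Function.ne_iff.1 hc
    refine (hs k).2.2.ne' (measure_mono_null (t := {θ | ε / (∑ k, |c k|) * g θ = 0}ᶜ)
      (fun θ hθ h => ?_) h0)
    have h' : ε / (∑ k, |c k|) * g θ = 0 := h
    rw [hgs k θ hθ] at h'
    exact mul_ne_zero (div_pos hε hC).ne' hk h'

end Splitting

/-! ### Outcomes as a weak-* compact set of functionals on `L²` -/

section Functional

variable {Θ : Type*} [MeasurableSpace Θ] {K : ℕ} (μ : Measure Θ) [IsProbabilityMeasure μ]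

lemma memLp_two_of_bounded {f : Θ → ℝ} (hf : Measurable f) {C : ℝ} (h : ∀ θ, |f θ| ≤ C) :
    MemLp f 2 μ :=
  MemLp.of_bound hf.aestronglyMeasurable C (.of_forall h)

lemma Outcome.memLp_prob (α : Outcome Θ K) (j : Fin K) : MemLp (α.prob j) 2 μ :=
  memLp_two_of_bounded μ (α.measurable_prob j) (C := 1) fun θ => by
    rw [abs_of_nonneg (α.prob_nonneg j θ)]
    exact α.prob_le_one j θ

/-- The family of functionals on `L²` given by integration against the action probabilities of
an outcome. -/
def Outcome.functional (α : Outcome Θ K) (j : Fin K) : WeakDual ℝ (Lp ℝ 2 μ) :=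
  StrongDual.toWeakDual (InnerProductSpace.toDual ℝ (Lp ℝ 2 μ) ((α.memLp_prob μ j).toLp _))

lemma Outcome.functional_apply (α : Outcome Θ K) (j : Fin K) (f : Lp ℝ 2 μ) :
    α.functional μ j f = ∫ θ, f θ * α.prob j θ ∂μ := by
  change inner ℝ ((α.memLp_prob μ j).toLp _) f = _
  rw [L2.inner_def]
  refine integral_congr_ae ?_
  filter_upwards [(α.memLp_prob μ j).coeFn_toLp] with θ hθ
  simp [hθ]

lemma Outcome.functional_toLp (α : Outcome Θ K) (j : Fin K) {f : Θ → ℝ} (hf : MemLp f 2 μ) :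
    α.functional μ j (hf.toLp f) = ∫ θ, f θ * α.prob j θ ∂μ := by
  rw [functional_apply]
  refine integral_congr_ae ?_
  filter_upwards [hf.coeFn_toLp] with θ hθ
  rw [hθ]

omit [IsProbabilityMeasure μ] in
lemma Outcome.integrable_mul_prob (α : Outcome Θ K) (j : Fin K) {f : Θ → ℝ} (hf : Integrable f μ) :
    Integrable (fun θ => f θ * α.prob j θ) μ :=
  hf.mul_bdd (c := 1) (α.measurable_prob j).aestronglyMeasurable (.of_forall fun θ => by
    rw [Real.norm_of_nonneg (α.prob_nonneg j θ)]
    exact α.prob_le_one j θ)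

lemma Outcome.prob_ae_eq_of_functional_eq {α β : Outcome Θ K} {j : Fin K}
    (h : α.functional μ j = β.functional μ j) : α.prob j =ᵐ[μ] β.prob j :=
  (MemLp.toLp_eq_toLp_iff _ _).1
    ((InnerProductSpace.toDual ℝ (Lp ℝ 2 μ)).injective (StrongDual.toWeakDual.injective h))

/-- Families of positive functionals whose sum is integration. -/
def positiveFamilies (K : ℕ) : Set (Fin K → WeakDual ℝ (Lp ℝ 2 μ)) :=
  {φ | (∀ j, ∀ f : Lp ℝ 2 μ, 0 ≤ f → 0 ≤ φ j f) ∧ ∀ f : Lp ℝ 2 μ, ∑ j, φ j f = ∫ θ, f θ ∂μ}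

omit [IsProbabilityMeasure μ] in
lemma continuous_eval (j : Fin K) (f : Lp ℝ 2 μ) :
    Continuous fun φ : Fin K → WeakDual ℝ (Lp ℝ 2 μ) => φ j f :=
  (WeakDual.eval_continuous f).comp (continuous_apply j)

lemma integral_le_norm (f : Lp ℝ 2 μ) : ∫ θ, f θ ∂μ ≤ ‖f‖ := by
  have h := L2.inner_indicatorConstLp_one (𝕜 := ℝ) (MeasurableSet.univ) (measure_ne_top μ _) f
  rw [setIntegral_univ] at h
  rw [← h]
  refine (real_inner_le_norm _ _).trans ?_
  rw [norm_indicatorConstLp (by norm_num) (by norm_num)]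
  simp

/-- Banach–Alaoglu: the defining conditions are weak-* closed, and positivity with the sum condition
gives `|φ j f| ≤ φ j |f| ≤ ∫ |f| ≤ ‖f‖`, so each functional lies in the unit ball. -/
lemma isCompact_positiveFamilies (K : ℕ) : IsCompact (positiveFamilies μ K) := by
  have hcl : IsClosed (positiveFamilies μ K) := by
    simp only [positiveFamilies, Set.ofPred_and, Set.ofPred_forall]
    refine IsClosed.inter ?_ ?_
    · exact isClosed_iInter fun j => isClosed_iInter fun f => isClosed_iInter fun _ =>
        isClosed_le continuous_const (continuous_eval μ j f)
    · exact isClosed_iInter fun f => isClosed_eq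
        (continuous_finsetSum _ fun j _ => continuous_eval μ j f) continuous_const
  refine (isCompact_univ_pi fun _ : Fin K =>
    WeakDual.isCompact_closedBall (0 : StrongDual ℝ (Lp ℝ 2 μ)) 1).of_isClosed_subset hcl ?_
  rintro φ ⟨hpos, hsum⟩ j -
  rw [Set.mem_preimage, mem_closedBall_zero_iff]
  refine ContinuousLinearMap.opNorm_le_bound _ zero_le_one fun f => ?_
  change |φ j f| ≤ 1 * ‖f‖
  have h1 : |φ j f| ≤ φ j |f| := by
    rw [abs_le']
    have ha := hpos j (|f| - f) (sub_nonneg.2 (le_abs_self f))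
    have hb := hpos j (|f| + f) (neg_le_iff_add_nonneg.1 (neg_le_abs f))
    rw [map_sub] at ha
    rw [map_add] at hb
    constructor <;> linarith
  have h2 : φ j |f| ≤ ∑ i, φ i |f| :=
    Finset.single_le_sum (fun i _ => hpos i _ (abs_nonneg f)) (Finset.mem_univ j)
  rw [one_mul, ← norm_abs_eq_norm f]
  exact h1.trans (h2.trans ((hsum _).trans_le (integral_le_norm μ _)))

lemma Outcome.functional_mem_positiveFamilies (α : Outcome Θ K) :
    α.functional μ ∈ positiveFamilies μ K := by
  refine ⟨fun j f hf => ?_, fun f => ?_⟩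
  · rw [functional_apply]
    refine integral_nonneg_of_ae ?_
    filter_upwards [(Lp.coeFn_nonneg f).2 hf] with θ hθ
    exact mul_nonneg hθ (α.prob_nonneg j θ)
  · simp_rw [functional_apply]
    rw [← integral_finsetSum _ fun j _ =>
      α.integrable_mul_prob μ j ((Lp.memLp f).integrable one_le_two)]
    simp_rw [← Finset.mul_sum, α.sum_prob, mul_one]

/-- Every such family is given by an outcome. -/
lemma exists_functional_eq [NeZero K] {φ : Fin K → WeakDual ℝ (Lp ℝ 2 μ)}
    (hφ : φ ∈ positiveFamilies μ K) : ∃ α : Outcome Θ K, α.functional μ = φ := by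
  classical
  obtain ⟨hpos, hsum⟩ := hφ
  let g : Fin K → Lp ℝ 2 μ := fun j =>
    (InnerProductSpace.toDual ℝ (Lp ℝ 2 μ)).symm (WeakDual.toStrongDual (φ j))
  have hg : ∀ j f, inner ℝ (g j) f = φ j f := fun j f => by
    simp [g]
  -- Testing on indicators turns positivity and the sum condition into almost everywhere statements
  -- about the Riesz representatives.
  have hgs : ∀ j (s : Set Θ) (hs : MeasurableSet s),
      φ j (indicatorConstLp 2 hs (measure_ne_top μ s) 1) = ∫ θ in s, g j θ ∂μ := fun j s hs => by
    rw [← hg, real_inner_comm]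
    exact L2.inner_indicatorConstLp_one hs (measure_ne_top μ s) (g j)
  have hint : ∀ j, Integrable (g j) μ := fun j => (Lp.memLp (g j)).integrable one_le_two
  have h0 : ∀ j, 0 ≤ᵐ[μ] g j := fun j => by
    refine ae_nonneg_of_forall_setIntegral_nonneg (hint j) fun s hs _ => ?_
    rw [← hgs j s hs]
    refine hpos j _ ((Lp.coeFn_nonneg _).1 ?_)
    filter_upwards [indicatorConstLp_coeFn (p := 2) (hs := hs) (hμs := measure_ne_top μ s)
      (c := (1 : ℝ))] with θ hθ
    rw [hθ]
    exact Set.indicator_nonneg (fun _ _ => zero_le_one) θ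
  have h1 : (fun θ => ∑ j, g j θ) =ᵐ[μ] fun _ => 1 := by
    refine Integrable.ae_eq_of_forall_setIntegral_eq _ _ (integrable_finsetSum _ fun j _ => hint j)
      (integrable_const _) fun s hs _ => ?_
    rw [integral_finsetSum _ fun j _ => (hint j).integrableOn]
    simp_rw [← hgs _ s hs]
    rw [hsum, integral_indicatorConstLp]
    simp
  let G : Set Θ := {θ | (fun j => g j θ) ∈ stdSimplex ℝ (Fin K)}
  have hmeas : Measurable fun θ => fun j => g j θ :=
    measurable_pi_lambda _ fun j => (Lp.stronglyMeasurable (g j)).measurable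
  have hG : MeasurableSet G := hmeas (isClosed_stdSimplex ℝ (Fin K)).measurableSet
  have hGae : ∀ᵐ θ ∂μ, θ ∈ G := by
    filter_upwards [ae_all_iff.2 h0, h1] with θ ha hb
    exact ⟨ha, hb⟩
  let p : Θ → Fin K → ℝ := G.piecewise (fun θ j => g j θ) fun _ => (vertex 0).1
  have hp : ∀ θ, p θ ∈ stdSimplex ℝ (Fin K) := fun θ => by
    by_cases h : θ ∈ G
    · simp only [p, h, Set.piecewise_eq_of_mem]
      exact h
    · simp only [p, h, not_false_eq_true, Set.piecewise_eq_of_notMem]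
      exact (vertex 0).2
  refine ⟨⟨fun θ => ⟨p θ, hp θ⟩, (hmeas.piecewise hG measurable_const).subtype_mk⟩, ?_⟩
  funext j
  refine DFunLike.ext _ _ fun f => ?_
  rw [Outcome.functional_apply, ← hg, L2.inner_def]
  refine integral_congr_ae ?_
  filter_upwards [hGae] with θ hθ
  simp [Outcome.prob, p, hθ]

end Functional

/-! ### Existence of a deterministic commitment outcome -/

section Existence

variable {Θ : Type*} [MeasurableSpace Θ] {K : ℕ}

lemma Outcome.shift_mem_stdSimplex (α : Outcome Θ K) {i j : Fin K} (hij : i ≠ j) {θ : Θ} {x : ℝ}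
    (hi : 0 ≤ α.prob i θ + x) (hj : 0 ≤ α.prob j θ - x) :
    (fun k => α.prob k θ + x * ((vertex i).1 k - (vertex j).1 k)) ∈ stdSimplex ℝ (Fin K) := by
  refine ⟨fun k => ?_, ?_⟩
  · rcases eq_or_ne k i with rfl | hki
    · simpa [vertex_apply, hij] using hi
    · rcases eq_or_ne k j with rfl | hkj
      · simpa [vertex_apply, hki, sub_eq_add_neg] using hj
      · simpa [vertex_apply, hki, hkj] using α.prob_nonneg k θ
  · rw [Finset.sum_add_distrib, α.sum_prob, ← Finset.mul_sum, Finset.sum_sub_distrib]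
    simp [vertex_apply]

/-- Shifting probability `h` from action `j` to action `i`. -/
def Outcome.shift (α : Outcome Θ K) {i j : Fin K} (hij : i ≠ j) {h : Θ → ℝ} (hm : Measurable h)
    (hi : ∀ θ, 0 ≤ α.prob i θ + h θ) (hj : ∀ θ, 0 ≤ α.prob j θ - h θ) : Outcome Θ K where
  toFun θ := ⟨_, α.shift_mem_stdSimplex hij (hi θ) (hj θ)⟩
  measurable := (measurable_pi_lambda _ fun k =>
    (α.measurable_prob k).add (hm.mul_const _)).subtype_mk

lemma Outcome.prob_shift (α : Outcome Θ K) {i j : Fin K} (hij : i ≠ j) {h : Θ → ℝ}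
    (hm : Measurable h) (hi : ∀ θ, 0 ≤ α.prob i θ + h θ) (hj : ∀ θ, 0 ≤ α.prob j θ - h θ)
    (k : Fin K) (θ : Θ) : (α.shift hij hm hi hj).prob k θ =
      α.prob k θ + h θ * ((vertex i).1 k - (vertex j).1 k) := rfl

variable {μ : Measure Θ} [IsProbabilityMeasure μ]

lemma Outcome.functional_shift (α : Outcome Θ K) {i j : Fin K} (hij : i ≠ j) {h : Θ → ℝ}
    (hm : Measurable h) (hi : ∀ θ, 0 ≤ α.prob i θ + h θ) (hj : ∀ θ, 0 ≤ α.prob j θ - h θ)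
    (hL : MemLp h 2 μ) (k : Fin K) (f : Lp ℝ 2 μ) : (α.shift hij hm hi hj).functional μ k f =
      α.functional μ k f + (∫ θ, f θ * h θ ∂μ) * ((vertex i).1 k - (vertex j).1 k) := by
  have hfh : Integrable (fun θ => f θ * h θ) μ := (Lp.memLp f).integrable_mul hL
  simp_rw [functional_apply, prob_shift, mul_add, ← mul_assoc]
  rw [integral_add (α.integrable_mul_prob μ k ((Lp.memLp f).integrable one_le_two))
    (hfh.mul_const _), integral_mul_const]

lemma Outcome.exAnte_eq_functional (α : Outcome Θ K) (v : Fin K → ℝ) (h1 : MemLp (1 : Θ → ℝ) 2 μ) :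
    α.exAnte μ v = ∑ j, v j * α.functional μ j (h1.toLp 1) := by
  simp_rw [functional_toLp, exAnte, interim, Pi.one_apply, one_mul]
  rw [integral_finsetSum _ fun j _ =>
    (((α.memLp_prob μ j).integrable one_le_two).const_mul _)]
  simp_rw [integral_const_mul]

omit [IsProbabilityMeasure μ] in
/-- An outcome that is not deterministic almost everywhere randomizes between two actions, with
probabilities bounded away from zero, on a set of positive measure. -/
lemma Outcome.exists_randomization (α : Outcome Θ K) (h : ¬ ∀ᵐ θ ∂μ, ∃ j, α.prob j θ = 1) :
    ∃ i j, i ≠ j ∧ ∃ ε > 0, 0 < μ {θ | ε ≤ α.prob i θ ∧ ε ≤ α.prob j θ} := by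
  by_contra! hcon
  refine h ?_
  -- Countably many thresholds exhaust the event that both probabilities are positive.
  have hz : ∀ i j, i ≠ j → ∀ n : ℕ, ∀ᵐ θ ∂μ,
      ¬ (1 / (n + 1 : ℝ) ≤ α.prob i θ ∧ 1 / (n + 1 : ℝ) ≤ α.prob j θ) := fun i j hij n =>
    measure_eq_zero_iff_ae_notMem.1 (nonpos_iff_eq_zero.1 (hcon i j hij _ (by positivity)))
  have hz' : ∀ᵐ θ ∂μ, ∀ i j, i ≠ j → ∀ n : ℕ,
      ¬ (1 / (n + 1 : ℝ) ≤ α.prob i θ ∧ 1 / (n + 1 : ℝ) ≤ α.prob j θ) := by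
    simp_rw [ae_all_iff]
    exact hz
  filter_upwards [hz'] with θ hθ
  obtain ⟨i, -, hi⟩ : ∃ i ∈ Finset.univ, 0 < α.prob i θ := by
    refine Finset.exists_lt_of_sum_lt (f := fun _ => (0 : ℝ)) ?_
    rw [α.sum_prob]
    simp
  refine ⟨i, ?_⟩
  rw [← α.sum_prob θ]
  refine (Finset.sum_eq_single i (fun j _ hji => ?_) (by simp)).symm
  by_contra hne
  have hj : 0 < α.prob j θ := lt_of_le_of_ne (α.prob_nonneg j θ) (Ne.symm hne)
  obtain ⟨n, hn⟩ := exists_nat_one_div_lt (lt_min hi hj)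
  exact hθ i j hji.symm n ⟨(hn.le.trans (min_le_left _ _)), hn.le.trans (min_le_right _ _)⟩

variable {v : Fin K → ℝ} {u : Fin K → Θ → ℝ}

omit [IsProbabilityMeasure μ] in
lemma Outcome.IsCommitment.congr_ae {α β : Outcome Θ K}
    (h : ∀ᵐ θ ∂μ, β.toFun θ = α.toFun θ) (hα : α.IsCommitment μ v u) : β.IsCommitment μ v u :=
  ⟨hα.1.congr_ae h, fun γ hγ => (hα.2 γ hγ).trans_eq (exAnte_congr_ae h).symm⟩

omit [IsProbabilityMeasure μ] in
/-- The receiver's complete-information optimum is obedient. -/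
lemma exists_isObedient [NeZero K] (hu : ∀ j, Measurable (u j)) :
    ∃ α : Outcome Θ K, α.IsObedient μ u := by
  obtain ⟨b, hb, hbopt, -⟩ := exists_measurable_lowest_action
    (v := fun j : Fin K => (j : ℝ)) (fun i j h => Nat.cast_lt.2 h) hu
  refine ⟨.ofAction b hb, (Outcome.isObedient_ofAction_iff hb).2 fun j j' => ?_⟩
  refine setIntegral_nonneg (hb (measurableSet_singleton j)) fun θ hθ => ?_
  have := hbopt θ j'
  rw [show b θ = j from hθ] at this
  exact sub_nonneg.2 this

lemma exists_isCommitment_ae_deterministic [TopologicalSpace Θ] [T2Space Θ]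
    [HereditarilyLindelofSpace Θ] [OpensMeasurableSpace Θ] [NullSingletonClass μ] [NeZero K]
    (hu : ∀ j, Measurable (u j)) (hbdd : ∃ C : ℝ, ∀ j θ, |u j θ| ≤ C) :
    ∃ α : Outcome Θ K, α.IsCommitment μ v u ∧ ∀ᵐ θ ∂μ, ∃ j, α.prob j θ = 1 := by
  obtain ⟨C, hC⟩ := hbdd
  have hw : ∀ j j', MemLp (fun θ => u j θ - u j' θ) 2 μ := fun j j' =>
    (memLp_two_of_bounded μ (hu j) (hC j)).sub (memLp_two_of_bounded μ (hu j') (hC j'))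
  have h1 : MemLp (1 : Θ → ℝ) 2 μ := memLp_const 1
  let obj : (Fin K → WeakDual ℝ (Lp ℝ 2 μ)) → ℝ := fun φ => ∑ j, v j * φ j (h1.toLp 1)
  have hobj : Continuous obj :=
    continuous_finsetSum _ fun j _ => (continuous_eval μ j _).const_mul _
  have hobj' : ∀ α : Outcome Θ K, obj (α.functional μ) = α.exAnte μ v := fun α =>
    (α.exAnte_eq_functional v h1).symm
  let O : Set (Fin K → WeakDual ℝ (Lp ℝ 2 μ)) := {φ | ∀ j j', 0 ≤ φ j ((hw j j').toLp _)}
  have hOcl : IsClosed O := by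
    simp only [O, Set.ofPred_forall]
    exact isClosed_iInter fun j => isClosed_iInter fun j' =>
      isClosed_le continuous_const (continuous_eval μ j _)
  have hO : ∀ α : Outcome Θ K, α.functional μ ∈ O ↔ α.IsObedient μ u := fun α =>
    forall₂_congr fun j j' => by rw [α.functional_toLp μ]
  have hTc : IsCompact (positiveFamilies μ K ∩ O) :=
    (isCompact_positiveFamilies μ K).inter_right hOcl
  obtain ⟨α₀, hα₀⟩ := exists_isObedient (μ := μ) hu
  obtain ⟨φ₀, hφ₀, hmax⟩ := hTc.exists_isMaxOn
    ⟨_, α₀.functional_mem_positiveFamilies μ, (hO α₀).2 hα₀⟩ hobj.continuousOn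
  have : LocallyConvexSpace ℝ (WeakDual ℝ (Lp ℝ 2 μ)) :=
    WeakBilin.locallyConvexSpace (B := topDualPairing ℝ (Lp ℝ 2 μ))
  obtain ⟨φ, hφ⟩ := (hTc.inter_right
    (isClosed_le (continuous_const (y := obj φ₀)) hobj)).extremePoints_nonempty ⟨φ₀, hφ₀, le_refl (obj φ₀)⟩
  rw [mem_extremePoints] at hφ
  obtain ⟨⟨⟨hφS, hφO⟩, hφmax⟩, hext⟩ := hφ
  obtain ⟨α, rfl⟩ := exists_functional_eq μ hφS
  refine ⟨α, ⟨(hO α).1 hφO, fun β hβ => ?_⟩, ?_⟩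
  · rw [← hobj', ← hobj']
    exact (hmax ⟨β.functional_mem_positiveFamilies μ, (hO β).2 hβ⟩).trans hφmax
  by_contra hdet
  obtain ⟨i, j, hij, ε, hε, hpos⟩ := α.exists_randomization hdet
  -- The index `none` stands for the constant `1`, which preserves the objective; the pairs preserve
  -- the obedience constraints.
  obtain ⟨h, hm, hle, hoff, horth, hne⟩ := exists_orthogonal_perturbation μ
    ((measurableSet_le measurable_const (α.measurable_prob i)).inter
      (measurableSet_le measurable_const (α.measurable_prob j))) hpos
    (f := fun o : Option (Fin K × Fin K) => o.elim 1 fun p θ => u p.1 θ - u p.2 θ)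
    (by
      rintro (_ | ⟨k, k'⟩)
      · exact h1.integrable one_le_two
      · exact (hw k k').integrable one_le_two) hε
  have hL : MemLp h 2 μ := memLp_two_of_bounded μ hm hle
  have hbd : ∀ θ, |h θ| ≤ α.prob i θ ∧ |h θ| ≤ α.prob j θ := fun θ => by
    by_cases hθ : θ ∈ {θ | ε ≤ α.prob i θ ∧ ε ≤ α.prob j θ}
    · exact ⟨(hle θ).trans hθ.1, (hle θ).trans hθ.2⟩
    · rw [hoff θ hθ, abs_zero]
      exact ⟨α.prob_nonneg i θ, α.prob_nonneg j θ⟩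
  let F := (positiveFamilies μ K ∩ O) ∩ {φ | obj φ₀ ≤ obj φ}
  have hshift : ∀ (g : Θ → ℝ) (hg : Measurable g) (hi : ∀ θ, 0 ≤ α.prob i θ + g θ)
      (hj : ∀ θ, 0 ≤ α.prob j θ - g θ), MemLp g 2 μ →
      (∀ f (hf : MemLp f 2 μ), ∫ θ, f θ * h θ ∂μ = 0 → ∫ θ, hf.toLp f θ * g θ ∂μ = 0) →
      (α.shift hij hg hi hj).functional μ ∈ F := by
    intro g hg hi hj hgL horth'
    have heq : ∀ f (hf : MemLp f 2 μ), ∫ θ, f θ * h θ ∂μ = 0 → ∀ k,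
        (α.shift hij hg hi hj).functional μ k (hf.toLp f) = α.functional μ k (hf.toLp f) :=
      fun f hf h0 k => by rw [α.functional_shift hij hg hi hj hgL, horth' f hf h0]; simp
    refine ⟨⟨Outcome.functional_mem_positiveFamilies μ _, fun k k' => ?_⟩, ?_⟩
    · exact (hφO k k').trans_eq (heq _ (hw k k') (horth (some (k, k'))) k).symm
    · refine (show obj φ₀ ≤ obj _ from hφmax).trans_eq (Finset.sum_congr rfl fun k _ => ?_)
      rw [heq _ h1 (horth none)]
  have hmul : ∀ f (hf : MemLp f 2 μ), ∫ θ, hf.toLp f θ * h θ ∂μ = ∫ θ, f θ * h θ ∂μ :=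
    fun f hf => integral_congr_ae (hf.coeFn_toLp.mono fun θ hθ => by simp only [hθ])
  have hi₁ : ∀ θ, 0 ≤ α.prob i θ + h θ := fun θ => by
    linarith [(hbd θ).1, neg_abs_le (h θ)]
  have hj₁ : ∀ θ, 0 ≤ α.prob j θ - h θ := fun θ => by
    linarith [(hbd θ).2, le_abs_self (h θ)]
  have hi₂ : ∀ θ, 0 ≤ α.prob i θ + (-h) θ := fun θ => by
    simp only [Pi.neg_apply]
    linarith [(hbd θ).1, le_abs_self (h θ)]
  have hj₂ : ∀ θ, 0 ≤ α.prob j θ - (-h) θ := fun θ => by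
    simp only [Pi.neg_apply]
    linarith [(hbd θ).2, neg_abs_le (h θ)]
  have hF₁ := hshift h hm hi₁ hj₁ hL fun f hf h0 => (hmul f hf).trans h0
  have hF₂ := hshift (-h) hm.neg hi₂ hj₂ hL.neg fun f hf h0 => by
    simp only [Pi.neg_apply, mul_neg, integral_neg, neg_eq_zero]
    exact (hmul f hf).trans h0
  -- `α` is the midpoint of the shifts by `h` and `-h`, so extremality forces `h` to vanish almost
  -- everywhere.
  have hmid := (hext _ hF₁ _ hF₂ ⟨1 / 2, 1 / 2, by norm_num, by norm_num, by norm_num, by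
    funext k
    refine DFunLike.ext _ _ fun f => ?_
    change 1 / 2 * (α.shift hij hm hi₁ hj₁).functional μ k f +
      1 / 2 * (α.shift hij hm.neg hi₂ hj₂).functional μ k f = _
    rw [α.functional_shift hij hm hi₁ hj₁ hL, α.functional_shift hij hm.neg hi₂ hj₂ hL.neg]
    simp only [Pi.neg_apply, mul_neg, integral_neg]
    ring⟩).1
  refine hne ?_
  filter_upwards [Outcome.prob_ae_eq_of_functional_eq μ (congrFun hmid i)] with θ hθ
  rw [Outcome.prob_shift] at hθ
  simpa [vertex_apply, hij] using hθ

/-- States in null cells can be moved to a cell of positive measure. -/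
lemma exists_noNullCell_ae_eq [NeZero K] {a : Θ → Fin K} (ha : Measurable a) :
    ∃ (c : Θ → Fin K) (hc : Measurable c), (Outcome.ofAction c hc).NoNullCell μ ∧
      ∀ᵐ θ ∂μ, c θ = a θ := by
  classical
  have hae : ∀ᵐ θ ∂μ, μ (a ⁻¹' {a θ}) ≠ 0 :=
    measure_eq_zero_iff_ae_notMem.1 (measure_null_cells μ a)
  obtain ⟨θ₀, hθ₀⟩ := hae.exists
  -- `r` fixes every action whose cell has positive measure and takes only such values, so each
  -- nonempty new cell contains an old cell of positive measure.
  let r : Fin K → Fin K := fun j => if μ (a ⁻¹' {j}) = 0 then a θ₀ else j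
  have hr : ∀ j, μ (a ⁻¹' {r j}) ≠ 0 := fun j => by
    by_cases h : μ (a ⁻¹' {j}) = 0
    · simpa only [r, h, if_true] using hθ₀
    · simpa only [r, if_neg h] using h
  have hrr : ∀ j, μ (a ⁻¹' {j}) ≠ 0 → r j = j := fun j h => if_neg h
  refine ⟨r ∘ a, (measurable_of_finite r).comp ha, fun j hj => ?_, hae.mono fun θ hθ => hrr _ hθ⟩
  rw [Outcome.cell_ofAction] at hj ⊢
  obtain ⟨θ, rfl⟩ := hj
  refine (pos_iff_ne_zero.2 (hr (a θ))).trans_le (measure_mono fun θ' hθ' => ?_)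
  change r (a θ') = r (a θ)
  rw [show a θ' = r (a θ) from hθ']
  exact hrr _ (hr _)

theorem exists_isCommitment_isDeterministic [TopologicalSpace Θ] [T2Space Θ]
    [HereditarilyLindelofSpace Θ] [OpensMeasurableSpace Θ] [NullSingletonClass μ] [NeZero K]
    (hu : ∀ j, Measurable (u j)) (hbdd : ∃ C : ℝ, ∀ j θ, |u j θ| ≤ C) :
    ∃ α : Outcome Θ K, α.IsCommitment μ v u ∧ α.IsDeterministic ∧ α.NoNullCell μ := by
  obtain ⟨α, hα, hdet⟩ := exists_isCommitment_ae_deterministic (μ := μ) (v := v) hu hbdd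
  -- With `α.prob` in place of the receiver's payoff, the selection picks an action of maximal
  -- probability, which is the certain action wherever there is one.
  obtain ⟨a, ha, hopt, -⟩ := exists_measurable_lowest_action
    (v := fun j : Fin K => (j : ℝ)) (fun i j h => Nat.cast_lt.2 h) α.measurable_prob
  obtain ⟨c, hc, hnull, hca⟩ := exists_noNullCell_ae_eq (μ := μ) ha
  refine ⟨.ofAction c hc, hα.congr_ae ?_, Outcome.isDeterministic_ofAction c hc, hnull⟩
  filter_upwards [hdet, hca] with θ ⟨j, hj⟩ hθ
  have : α.prob (a θ) θ = 1 := le_antisymm (α.prob_le_one _ θ) (hj ▸ hopt θ j)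
  rw [eq_vertex_of_apply_eq_one (α.toFun θ) (a θ) this, ← hθ]
  rfl

end Existence

end Persuasion
end

/-! ### The proposition -/

theorem mainTheorem3 {n : ℕ} (Θ : Set (EuclideanSpace ℝ (Fin n)))
    (hcompact : IsCompact Θ) (hconvex : Convex ℝ Θ)
    (μ₀ : Measure Θ) [IsProbabilityMeasure μ₀] [NullSingletonClass μ₀] (hsupp : μ₀.support = Set.univ)
    {K : ℕ} (hK : 2 ≤ K)
    (v : Fin K → ℝ) (hv : StrictMono v)
    (u : Fin K → Θ → ℝ) (hu : ∀ j, Measurable (u j)) (hbdd : ∃ C : ℝ, ∀ j θ, |u j θ| ≤ C)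
    [MeasurableSpace (Persuasion.Message Θ)] [MeasurableSingletonClass (Persuasion.Message Θ)] :
    -- a deterministic commitment outcome exists
    (∃ α : Persuasion.Outcome Θ K,
      α.IsCommitment μ₀ v u ∧ α.IsDeterministic ∧ α.NoNullCell μ₀) ∧
    -- a deterministic commitment outcome is an equilibrium outcome if and only if it is IC
    (∀ α : Persuasion.Outcome Θ K, α.IsCommitment μ₀ v u → α.IsDeterministic →
      (α.IsEquilibriumOutcome μ₀ v u → α.IsIC v u) ∧
      (α.NoNullCell μ₀ → (α.IsEquilibriumOutcome μ₀ v u ↔ α.IsIC v u)) ∧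
      -- the same without a condition on the cells, up to null sets of states
      ((∃ β : Persuasion.Outcome Θ K, β.IsEquilibriumOutcome μ₀ v u ∧
          ∀ᵐ θ ∂μ₀, β.toFun θ = α.toFun θ) ↔
        ∀ᵐ θ ∂μ₀, α.ICAt v u θ)) := by
  have : NeZero K := ⟨by omega⟩
  refine ⟨Persuasion.exists_isCommitment_isDeterministic hu hbdd, fun α hα hdet =>
    ⟨fun h => h.isIC, fun hnull => ⟨fun h => h.isIC, fun hIC => ?_⟩, ?_, fun hIC =>
      Persuasion.Outcome.exists_isEquilibriumOutcome_ae_eq hv hu hbdd hdet hα.1 hIC⟩⟩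
  · obtain ⟨a, ha, rfl⟩ := hdet.exists_eq_ofAction
    refine Persuasion.Outcome.isEquilibriumOutcome_ofAction hv hu hbdd ha hα.1 hIC fun j hj => ?_
    rw [← Persuasion.Outcome.cell_ofAction a ha] at hj ⊢
    exact Or.inl (hnull j hj)
  · rintro ⟨β, hβ, hae⟩
    filter_upwards [hae] with θ hθ
    have := hβ.isIC θ
    simpa only [Persuasion.Outcome.ICAt, Persuasion.Outcome.interim, Persuasion.Outcome.prob, hθ]
      using this
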